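/- Let $X$ be a fixed $n\times p$ matrix with rows $x_1^{\rm t},\ldots,x_n^{\rm t}$, with $m=n-p\ge 1$, such that $\Sigma_n=n^{-1}\sum_{i=1}^n x_ix_i^{\rm t}$ has full rank $p$. Let $y_i=x_i^{\rm t}\beta+\varepsilon_i$ for $i=1,\ldots,n$, with $\varepsilon_1,\ldots,\varepsilon_n$ i.i.d. ${\rm N}(0,\sigma^2)$, $\beta\in\mathbb R^p$, $\sigma>0$. Let $\widehat\beta=\Sigma_n^{-1}n^{-1}\sum_i x_iy_i$ and $\widehat\sigma^2=m^{-1}\sum_i(y_i-x_i^{\rm t}\widehat\beta)^2$. Fix $x_0\in\mathbb R^p$ and $S\subseteq\{1,\ldots,p\}$; write $u_S$ and $u_{S^c}$ for the subvectors of $u\in\mathbb R^p$ with coordinates in $S$ and outside $S$, let $\Sigma_{n,S}$ be the $S\times S$ block and $\Sigma_{10,S}$ the $S^c\times S$ block of $\Sigma_n$, let $Q_S$ be the $S^c\times S^c$ block of $\Sigma_n^{-1}$, and $$\omega_S=\Sigma_{10,S}\Sigma_{n,S}^{-1}x_{0,S}-x_{0,S^c},$$ where we assume $\omega_S\ne0$.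 Let $\mu=x_0^{\rm t}\beta$, $\widehat\mu_{\rm wide}=x_0^{\rm t}\widehat\beta$, $\widehat\mu_S=x_{0,S}^{\rm t}\widehat\beta_S$ with $\widehat\beta_S=\Sigma_{n,S}^{-1}n^{-1}\sum_i x_{i,S}y_i$, and $${\rm rr}_S=\frac{{\rm E}(\widehat\mu_S-\mu)^2}{{\rm E}(\widehat\mu_{\rm wide}-\mu)^2},\qquad {\rm rr}_{S,\min}=\frac{x_{0,S}^{\rm t}\Sigma_{n,S}^{-1}x_{0,S}}{x_0^{\rm t}\Sigma_n^{-1}x_0},$$ $$\kappa_S=\frac{\sqrt n\,\omega_S^{\rm t}\beta_{S^c}}{(\omega_S^{\rm t}Q_S\omega_S)^{1/2}\sigma},\qquad \widehat\kappa_S=\frac{\sqrt n\,\omega_S^{\rm t}\widehat\beta_{S^c}}{(\omega_S^{\rm t}Q_S\omega_S)^{1/2}\widehat\sigma}.$$ Let $t_m(\kappa)$ be the law of $N/(V/m)^{1/2}$ and, for $\lambda\ge0$, $F_{1,m}(\lambda)$ the law of $U/(V/m)$, where $V\sim\chi^2_m$ is independent of $N\sim{\rm N}(\kappa,1)$ and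 of $U\sim\chi^2_1(\lambda)$ (noncentral chi-squared); write $F_{1,m}(\cdot,\lambda)$ for the distribution function of $F_{1,m}(\lambda)$ and $F_{1,m}(\cdot)=F_{1,m}(\cdot,0)$ for that of the ordinary $F$ distribution. Then, for all $\beta\in\mathbb R^p$ and $\sigma>0$, $\widehat\kappa_S\sim t_m(\kappa_S)$, $\widehat\kappa_S^2\sim F_{1,m}(\kappa_S^2)$, and ${\rm rr}_S\ge{\rm rr}_{S,\min}$. Moreover $$C_S(r)=C_S(r,y)=1-F_{1,m}\Bigl(\widehat\kappa_S^2,\ \frac{x_0^{\rm t}\Sigma_n^{-1}x_0\,r-x_{0,S}^{\rm t}\Sigma_{n,S}^{-1}x_{0,S}}{\omega_S^{\rm t}Q_S\omega_S}\Bigr)\quad (r\ge{\rm rr}_{S,\min}),\qquad C_S(r)=0\quad(r<{\rm rr}_{S,\min}),$$ is an exact confidence distribution for ${\rm rr}_S$: for every data set $y$ the function $C_S(\cdot,y)$ is a cumulative distribution function, and ${\rm pr}_{\beta,\sigma}\{C_S({\rm rr}_S,y)\le\alpha\}=\alpha$ for all $\alpha\in(0,1)$, $\beta\in\mathbb R^p$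 and $\sigma>0$. The distribution with distribution function $C_S(\cdot,y)$ has a point mass at ${\rm rr}_{S,\min}$, of positive size $1-F_{1,m}(\widehat\kappa_S^2)$, and $C_S(1)=1-F_{1,m}(\widehat\kappa_S^2,1)$. (For the probability-zero set of data with $\widehat\sigma=0$ we put $\widehat\kappa_S=0$.) -/

import Mathlib

open MeasureTheory ProbabilityTheory Filter Topology Matrix

noncomputable section

/-! ### Chi-squared, `t` and `F` distributions -/

/-- The noncentral chi-squared distribution with `d` degrees of freedom and noncentrality
(excentre) parameter `lam ≥ 0`: the law of `Z₁² + ⋯ + Z_d²` for independent normal variables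
of unit variance, where `Z₁` has mean `√lam` and the others have mean zero. -/
def noncentralChiSquared (d : ℕ) (lam : ℝ) : Measure ℝ :=
  (Measure.pi fun i : Fin d => gaussianReal (if i.val = 0 then √lam else 0) 1).map
    fun z => ∑ i, z i ^ 2

/-- The chi-squared distribution with `m` degrees of freedom: the law of the sum of squares
of `m` independent standard normal variables. -/
def chiSquared (m : ℕ) : Measure ℝ :=
  (Measure.pi fun _ : Fin m => gaussianReal 0 1).map fun z => ∑ i, z i ^ 2

/-- The noncentral `t` distribution with `m` degrees of freedom and excentre parameter `k`:
the law of `N / √(V / m)` with `N ∼ N(k, 1)` and `V ∼ χ²_m` independent. -/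
def noncentralT (m : ℕ) (k : ℝ) : Measure ℝ :=
  ((gaussianReal k 1).prod (chiSquared m)).map fun z => z.1 / √(z.2 / m)

/-- The noncentral `F` distribution with degrees of freedom `(d, m)` and excentre parameter
`lam`: the law of `(U / d) / (V / m)` with `U ∼ χ²_d(lam)` and `V ∼ χ²_m` independent. -/
def noncentralF (d m : ℕ) (lam : ℝ) : Measure ℝ :=
  ((noncentralChiSquared d lam).prod (chiSquared m)).map fun z => (z.1 / d) / (z.2 / m)

/-- The ordinary `F` distribution with degrees of freedom `(d, m)`. -/
def centralF (d m : ℕ) : Measure ℝ :=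
  ((chiSquared d).prod (chiSquared m)).map fun z => (z.1 / d) / (z.2 / m)

/-! ### Exact confidence distributions -/

/-- `F` is a cumulative distribution function on the real line. -/
structure IsDistributionFunction (F : ℝ → ℝ) : Prop where
  monotone : Monotone F
  right_continuous : ∀ x, ContinuousWithinAt F (Set.Ici x) x
  tendsto_atBot : Tendsto F atBot (𝓝 0)
  tendsto_atTop : Tendsto F atTop (𝓝 1)

/-- `C` is an exact confidence distribution for the parameter `ψ` in the statistical model
`(P θ)_θ`: for each data set it is a cumulative distribution function, and at the true parameter
value it is uniformly distributed, for every `θ`. -/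
structure IsExactConfidenceDistribution {Θ Y : Type*} [MeasurableSpace Y]
    (P : Θ → Measure Y) (ψ : Θ → ℝ) (C : ℝ → Y → ℝ) : Prop where
  isDistributionFunction : ∀ y, IsDistributionFunction fun r => C r y
  measurable : ∀ r, Measurable (C r)
  exact_level : ∀ θ, ∀ α ∈ Set.Ioo (0 : ℝ) 1, (P θ).real {y | C (ψ θ) y ≤ α} = α

/-! ### The linear regression model and its submodels

The rows of `X` are the covariate vectors `x_i`. Submodels are indexed by sets `S` of covariates. -/

namespace FRIC

variable {n p : ℕ}

/-- The law of the data `y_i = x_iᵗβ + ε_i`, with the `ε_i` i.i.d. from `N(0, σ²)`. -/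
def model (X : Matrix (Fin n) (Fin p) ℝ) (β : Fin p → ℝ) (σ : ℝ) : Measure (Fin n → ℝ) :=
  (Measure.pi fun _ : Fin n => gaussianReal 0 (σ ^ 2).toNNReal).map fun ε => X *ᵥ β + ε

/-- `Σ_n = n⁻¹ ∑ x_i x_iᵗ`. -/
def gram (X : Matrix (Fin n) (Fin p) ℝ) : Matrix (Fin p) (Fin p) ℝ :=
  (n : ℝ)⁻¹ • ∑ i, vecMulVec (X i) (X i)

/-- `u_S`, the subvector of coordinates in `S`. -/
def inS (S : Finset (Fin p)) (u : Fin p → ℝ) : {j // j ∈ S} → ℝ := fun j => u j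

/-- `u_{Sᶜ}`, the subvector of coordinates outside `S`. -/
def outS (S : Finset (Fin p)) (u : Fin p → ℝ) : {j // j ∉ S} → ℝ := fun j => u j

/-- `Σ_{n,S} = Σ_{00,S}`. -/
def gramS (X : Matrix (Fin n) (Fin p) ℝ) (S : Finset (Fin p)) :
    Matrix {j // j ∈ S} {j // j ∈ S} ℝ :=
  (gram X).toBlock (· ∈ S) (· ∈ S)

/-- `Σ_{10,S}`. -/
def gram10 (X : Matrix (Fin n) (Fin p) ℝ) (S : Finset (Fin p)) :
    Matrix {j // j ∉ S} {j // j ∈ S} ℝ :=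
  (gram X).toBlock (· ∉ S) (· ∈ S)

/-- `Q_S = Σ^{11,S}`, the block of `Σ_n⁻¹` belonging to the covariates outside `S`. -/
def qMat (X : Matrix (Fin n) (Fin p) ℝ) (S : Finset (Fin p)) :
    Matrix {j // j ∉ S} {j // j ∉ S} ℝ :=
  (gram X)⁻¹.toBlock (· ∉ S) (· ∉ S)

/-- `ω_S = Σ_{10,S} Σ_{00,S}⁻¹ x_{0,S} - x_{0,Sᶜ}`. -/
def omegaS (X : Matrix (Fin n) (Fin p) ℝ) (x₀ : Fin p → ℝ) (S : Finset (Fin p)) :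
    {j // j ∉ S} → ℝ :=
  gram10 X S *ᵥ ((gramS X S)⁻¹ *ᵥ inS S x₀) - outS S x₀

/-- `x_0ᵗ Σ_n⁻¹ x_0`. -/
def quadWide (X : Matrix (Fin n) (Fin p) ℝ) (x₀ : Fin p → ℝ) : ℝ :=
  x₀ ⬝ᵥ ((gram X)⁻¹ *ᵥ x₀)

/-- `x_{0,S}ᵗ Σ_{n,S}⁻¹ x_{0,S}`. -/
def quadS (X : Matrix (Fin n) (Fin p) ℝ) (x₀ : Fin p → ℝ) (S : Finset (Fin p)) : ℝ :=
  inS S x₀ ⬝ᵥ ((gramS X S)⁻¹ *ᵥ inS S x₀)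

/-- `ω_Sᵗ Q_S ω_S`. -/
def quadOmega (X : Matrix (Fin n) (Fin p) ℝ) (x₀ : Fin p → ℝ) (S : Finset (Fin p)) : ℝ :=
  omegaS X x₀ S ⬝ᵥ (qMat X S *ᵥ omegaS X x₀ S)

/-- The least squares estimator of `β` in the wide model. -/
def betaHatWide (X : Matrix (Fin n) (Fin p) ℝ) (y : Fin n → ℝ) : Fin p → ℝ :=
  (gram X)⁻¹ *ᵥ ((n : ℝ)⁻¹ • ∑ i, y i • X i)

/-- The least squares estimator of `β_S` in the submodel `S`. -/
def betaHatS (X : Matrix (Fin n) (Fin p) ℝ) (S : Finset (Fin p)) (y : Fin n → ℝ) :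
    {j // j ∈ S} → ℝ :=
  (gramS X S)⁻¹ *ᵥ ((n : ℝ)⁻¹ • ∑ i, y i • inS S (X i))

/-- The unbiased variance estimator `(n - p)⁻¹ ∑ (y_i - x_iᵗ β̂_wide)²`. -/
def sigmaHatSq (X : Matrix (Fin n) (Fin p) ℝ) (y : Fin n → ℝ) : ℝ :=
  ((n : ℝ) - p)⁻¹ * ∑ i, (y i - X i ⬝ᵥ betaHatWide X y) ^ 2

/-- Mean squared error, under `(β, σ)`, of an estimator of the focus parameter `μ = x_0ᵗ β`. -/
def mse (X : Matrix (Fin n) (Fin p) ℝ) (x₀ β : Fin p → ℝ) (σ : ℝ)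
    (muHat : (Fin n → ℝ) → ℝ) : ℝ :=
  ∫ y, (muHat y - x₀ ⬝ᵥ β) ^ 2 ∂(model X β σ)

/-- The relative risk `rr_S = mse_S / mse_wide` of the estimators `μ̂_S = x_{0,S}ᵗ β̂_S` and
`μ̂_wide = x_0ᵗ β̂_wide`. -/
def rr (X : Matrix (Fin n) (Fin p) ℝ) (x₀ : Fin p → ℝ) (S : Finset (Fin p))
    (β : Fin p → ℝ) (σ : ℝ) : ℝ :=
  mse X x₀ β σ (fun y => inS S x₀ ⬝ᵥ betaHatS X S y) /
    mse X x₀ β σ (fun y => x₀ ⬝ᵥ betaHatWide X y)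

/-- `rr_{S,min}`. -/
def rrMin (X : Matrix (Fin n) (Fin p) ℝ) (x₀ : Fin p → ℝ) (S : Finset (Fin p)) : ℝ :=
  quadS X x₀ S / quadWide X x₀

/-- The parameter `κ_S`. -/
def kappa (X : Matrix (Fin n) (Fin p) ℝ) (x₀ : Fin p → ℝ) (S : Finset (Fin p))
    (β : Fin p → ℝ) (σ : ℝ) : ℝ :=
  √n * (omegaS X x₀ S ⬝ᵥ outS S β) / (√(quadOmega X x₀ S) * σ)

/-- The statistic `κ̂_S`. -/
def kappaHat (X : Matrix (Fin n) (Fin p) ℝ) (x₀ : Fin p → ℝ) (S : Finset (Fin p))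
    (y : Fin n → ℝ) : ℝ :=
  √n * (omegaS X x₀ S ⬝ᵥ outS S (betaHatWide X y)) / (√(quadOmega X x₀ S) * √(sigmaHatSq X y))

/-- The data-driven function `C_S(r, y)` on the relative risk scale. The formula is used from the
smallest possible value `rr_{S,min}` of the relative risk onwards; below it there is no
confidence. -/
def confDist (X : Matrix (Fin n) (Fin p) ℝ) (x₀ : Fin p → ℝ) (S : Finset (Fin p))
    (r : ℝ) (y : Fin n → ℝ) : ℝ :=
  if rrMin X x₀ S ≤ r then
    1 - cdf (noncentralF 1 (n - p) ((quadWide X x₀ * r - quadS X x₀ S) / quadOmega X x₀ S))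
      (kappaHat X x₀ S y ^ 2)
  else 0

end FRIC

end

/-! Put f = (Σ_S⁻¹ x_{0,S}, 0) and w = (0, ω_S). The identity Σ f = x₀ + w (`gram_mulVec_focusS`)
governs the algebra. The submodel estimator is n⁻¹(Xf)·y, so its bias is w·β and its variance is
σ²n⁻¹ fᵀΣf. As f and w have disjoint supports, x₀ᵀΣ⁻¹x₀ = fᵀΣf + wᵀΣ⁻¹w (`quadWide_eq_add`). Hence
the relative risk is an increasing affine function of κ², minimal at κ = 0 and equal to one at κ² =
1 (`quadWide_mul_rr`), and confidence about it is confidence about κ².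

The numerator of κ̂ is a linear statistic whose coefficient vector lies in the column space of X,
while the residual sum of squares is a sum of n - p squared orthonormal statistics orthogonal to
that space (`exists_orthonormal_residual`). Rotation invariance of the Gaussian law makes the two
independent, which gives the t law (`hasLaw_kappaHat`) and, after squaring, the F law. The latter
has no atoms, so the probability integral transform gives exact level.

For fixed data, C is a distribution function in r because λ ↦ F_{1,m}(x, λ) is continuous,
decreasing and tends to 0. Conditioning on the chi-squared denominator (`cdf_noncentralF`) reduces
this to the mass of a symmetric interval under N(a, 1), which decreases in a ≥ 0
(`antitoneOn_gaussianWindow`). The mass at the minimum is positive because F_{1,m}(x) < 1 for finite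
x. -/

/-! ### Linear images of a standard Gaussian vector -/

/-- A matrix with orthonormal rows maps a standard Gaussian vector to a standard Gaussian
vector. -/
theorem pi_gaussianReal_map_mulVec {ι κ : Type*} [Fintype ι] [Fintype κ] [DecidableEq ι]
    (A : Matrix ι κ ℝ) (hA : A * Aᵀ = 1) :
    (Measure.pi fun _ : κ => gaussianReal 0 1).map (fun z => A *ᵥ z) =
      Measure.pi fun _ : ι => gaussianReal 0 1 := by
  have hm : Measurable (fun z : κ → ℝ => A *ᵥ z) :=
    (Continuous.matrix_mulVec continuous_const continuous_id).measurable
  have hinj : (Measure.pi fun _ : κ => gaussianReal 0 1).map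
        ((WithLp.toLp 2 : (ι → ℝ) → EuclideanSpace ℝ ι) ∘ fun z => A *ᵥ z) =
      (Measure.pi fun _ : ι => gaussianReal 0 1).map (WithLp.toLp 2) := by
    rw [map_pi_eq_stdGaussian]
    have : IsProbabilityMeasure ((Measure.pi fun _ : κ => gaussianReal 0 1).map
        ((WithLp.toLp 2 : (ι → ℝ) → EuclideanSpace ℝ ι) ∘ fun z => A *ᵥ z)) :=
      Measure.isProbabilityMeasure_map (by fun_prop)
    -- The characteristic function of the image at `t` is the standard Gaussian one at `Aᵀ t`, which
    -- depends only on the norm; orthonormal rows give ‖Aᵀ t‖ = ‖t‖.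
    apply Measure.ext_of_charFun (E := EuclideanSpace ℝ ι)
    ext t
    rw [charFun_stdGaussian, charFun_apply, integral_map (by fun_prop) (by fun_prop)]
    have h1 := charFun_stdGaussian (E := EuclideanSpace ℝ κ) (WithLp.toLp 2 (Aᵀ *ᵥ t.ofLp))
    rw [← map_pi_eq_stdGaussian, charFun_apply, integral_map (by fun_prop) (by fun_prop)] at h1
    have h2 : ‖(WithLp.toLp 2 (Aᵀ *ᵥ t.ofLp) : EuclideanSpace ℝ κ)‖ ^ 2 = ‖t‖ ^ 2 := by
      rw [← real_inner_self_eq_norm_sq, ← real_inner_self_eq_norm_sq,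
        EuclideanSpace.inner_eq_star_dotProduct, EuclideanSpace.inner_eq_star_dotProduct]
      simp only [star_trivial]
      rw [Matrix.dotProduct_mulVec, Matrix.vecMul_transpose, Matrix.mulVec_mulVec, hA,
        Matrix.one_mulVec]
    have h3 : ∀ z : κ → ℝ,
        inner ℝ (((WithLp.toLp 2 : (ι → ℝ) → EuclideanSpace ℝ ι) ∘ fun z => A *ᵥ z) z) t =
          inner ℝ (WithLp.toLp 2 z : EuclideanSpace ℝ κ) (WithLp.toLp 2 (Aᵀ *ᵥ t.ofLp)) := by
      intro z
      rw [EuclideanSpace.inner_eq_star_dotProduct, EuclideanSpace.inner_eq_star_dotProduct]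
      simp only [Function.comp, star_trivial]
      rw [Matrix.dotProduct_mulVec, ← Matrix.mulVec_transpose]
    simp_rw [h3, h1, ← Complex.ofReal_pow, h2]
  have h := congrArg (Measure.map (WithLp.ofLp : EuclideanSpace ℝ ι → ι → ℝ)) hinj
  rw [Measure.map_map (by fun_prop) (by fun_prop), Measure.map_map (by fun_prop) (by fun_prop)] at h
  simpa [Function.comp_def] using h

theorem memLp_dotProduct_pi_gaussianReal {κ : Type*} [Fintype κ] (c : κ → ℝ) :
    MemLp (fun z => c ⬝ᵥ z) 2 (Measure.pi fun _ : κ => gaussianReal 0 1) := by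
  simp only [dotProduct]
  refine memLp_finsetSum _ fun i _ => MemLp.const_mul ?_ _
  exact (memLp_id_gaussianReal (μ := 0) (v := 1) 2).comp_measurePreserving
    (measurePreserving_eval (fun _ : κ => gaussianReal 0 1) i)

theorem integral_dotProduct_pi_gaussianReal {κ : Type*} [Fintype κ] (c : κ → ℝ) :
    ∫ z, c ⬝ᵥ z ∂(Measure.pi fun _ : κ => gaussianReal 0 1) = 0 := by
  simp only [dotProduct]
  rw [integral_finsetSum]
  · simp [integral_const_mul, integral_eval]
  · exact fun i _ => (integrable_eval IsGaussian.integrable_id).const_mul _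

theorem integral_dotProduct_sq_pi_gaussianReal {κ : Type*} [Fintype κ] (c : κ → ℝ) :
    ∫ z, (c ⬝ᵥ z) ^ 2 ∂(Measure.pi fun _ : κ => gaussianReal 0 1) = c ⬝ᵥ c := by
  have h : Var[fun z => c ⬝ᵥ z; Measure.pi fun _ : κ => gaussianReal 0 1] = c ⬝ᵥ c := by
    have : (fun z : κ → ℝ => c ⬝ᵥ z) = ∑ i, fun z : κ → ℝ => c i * z i := by
      ext z; simp [dotProduct]
    rw [this, variance_sum_pi (μ := fun _ : κ => gaussianReal 0 1) (X := fun i x => c i * x)]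
    · change ∑ i, Var[fun x ↦ _ * (id x); gaussianReal 0 1] = _
      simp_rw [variance_const_mul, variance_id_gaussianReal]
      simp [dotProduct, sq]
    · exact fun i ↦ IsGaussian.memLp_two_id.const_mul _
  rw [variance_eq_sub (memLp_dotProduct_pi_gaussianReal c),
    integral_dotProduct_pi_gaussianReal] at h
  simpa using h

theorem integral_sq_affine_pi_gaussianReal {κ : Type*} [Fintype κ] (c : κ → ℝ) (b s : ℝ) :
    ∫ z, (b + s * (c ⬝ᵥ z)) ^ 2 ∂(Measure.pi fun _ : κ => gaussianReal 0 1) =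
      b ^ 2 + s ^ 2 * (c ⬝ᵥ c) := by
  have hL := memLp_dotProduct_pi_gaussianReal c
  have h1 : Integrable (fun z => c ⬝ᵥ z) (Measure.pi fun _ : κ => gaussianReal 0 1) :=
    hL.integrable (by norm_num)
  have h2 : Integrable (fun z => (c ⬝ᵥ z) ^ 2) (Measure.pi fun _ : κ => gaussianReal 0 1) :=
    hL.integrable_sq
  have : (fun z : κ → ℝ => (b + s * (c ⬝ᵥ z)) ^ 2) =
      fun z => (b ^ 2 + 2 * b * s * (c ⬝ᵥ z)) + s ^ 2 * (c ⬝ᵥ z) ^ 2 := by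
    ext z; ring
  rw [this, integral_add (by fun_prop) (h2.const_mul _), integral_add (by fun_prop) (h1.const_mul _),
    integral_const_mul, integral_const_mul, integral_dotProduct_pi_gaussianReal,
    integral_dotProduct_sq_pi_gaussianReal]
  simp

namespace FRIC

variable {n p : ℕ}

/-! ### Linear algebra of the wide model and its submodels -/

theorem gram_eq (X : Matrix (Fin n) (Fin p) ℝ) : gram X = (n : ℝ)⁻¹ • (Xᵀ * X) := by
  ext i j
  simp [gram, Matrix.mul_apply, Matrix.sum_apply, vecMulVec_apply]

theorem sum_smul_row (X : Matrix (Fin n) (Fin p) ℝ) (y : Fin n → ℝ) :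
    ∑ i, y i • X i = Xᵀ *ᵥ y := by
  ext j
  simp [Matrix.mulVec, dotProduct, mul_comm]

theorem gram_transpose (X : Matrix (Fin n) (Fin p) ℝ) : (gram X)ᵀ = gram X := by
  simp [gram_eq]

theorem gram_posDef {X : Matrix (Fin n) (Fin p) ℝ} (hX : (gram X).rank = p) :
    (gram X).PosDef := by
  have h : (gram X).PosSemidef := by
    rw [gram_eq]
    have := Matrix.posSemidef_conjTranspose_mul_self X
    rw [Matrix.conjTranspose_eq_transpose_of_trivial] at this
    exact this.smul (by positivity)
  refine h.posDef_iff_isUnit.2 ?_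
  rw [← Matrix.linearIndependent_cols_iff_isUnit, linearIndependent_iff_card_eq_finrank_span,
    Set.finrank,
    ← Matrix.rank_eq_finrank_span_cols, hX, Fintype.card_fin]

theorem gram_rank_design {X : Matrix (Fin n) (Fin p) ℝ} (hX : (gram X).rank = p) :
    X.rank = p := by
  refine le_antisymm (by simpa using X.rank_le_width) ?_
  calc p = (gram X).rank := hX.symm
    _ = (((n : ℝ)⁻¹ • Xᵀ) * X).rank := by rw [gram_eq, Matrix.smul_mul]
    _ ≤ X.rank := Matrix.rank_mul_le_right _ _

theorem gramS_posDef {X : Matrix (Fin n) (Fin p) ℝ} (hX : (gram X).rank = p)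
    (S : Finset (Fin p)) : (gramS X S).PosDef :=
  (gram_posDef hX).submatrix Subtype.val_injective

/-- Extension by zero of a vector of coordinates satisfying a predicate. -/
def extend {P : Fin p → Prop} [DecidablePred P] (u : {j // P j} → ℝ) : Fin p → ℝ :=
  fun j => if h : P j then u ⟨j, h⟩ else 0

theorem extend_dotProduct {P : Fin p → Prop} [DecidablePred P] [inst : Fintype {j // P j}]
    (u : {j // P j} → ℝ)
    (v : Fin p → ℝ) : extend u ⬝ᵥ v = u ⬝ᵥ fun j : {j // P j} => v j := by
  -- The statement admits any `Fintype` instance, because membership in a `Finset` and its negation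
  -- need not come with the same one.
  obtain rfl : inst = Subtype.fintype P := Subsingleton.elim _ _
  simp only [dotProduct]
  rw [← Fintype.sum_subtype_add_sum_subtype P (fun j => extend u j * v j)]
  rw [Fintype.sum_congr _ _ (fun j : {j // P j} =>
      show extend u j * v j = u j * v j by simp [extend, j.2]),
    Fintype.sum_congr _ _ (fun j : {j // ¬ P j} =>
      show extend u j * v j = 0 by simp [extend, j.2])]
  simp

theorem mulVec_extend {P : Fin p → Prop} [DecidablePred P] [Fintype {j // P j}]
    (M : Matrix (Fin p) (Fin p) ℝ)
    (u : {j // P j} → ℝ) (j : Fin p) :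
    (M *ᵥ extend u) j = (fun k : {j // P j} => M j k) ⬝ᵥ u := by
  rw [Matrix.mulVec, dotProduct_comm, extend_dotProduct, dotProduct_comm]

/-- The vector `(Σ_{n,S}⁻¹ x_{0,S}, 0)`. -/
noncomputable def focusS (X : Matrix (Fin n) (Fin p) ℝ) (x₀ : Fin p → ℝ) (S : Finset (Fin p)) :
    Fin p → ℝ :=
  extend (P := (· ∈ S)) ((gramS X S)⁻¹ *ᵥ inS S x₀)

/-- The vector `(0, ω_S)`. -/
noncomputable def omegaExt (X : Matrix (Fin n) (Fin p) ℝ) (x₀ : Fin p → ℝ)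
    (S : Finset (Fin p)) : Fin p → ℝ :=
  extend (P := (· ∉ S)) (omegaS X x₀ S)

theorem omegaExt_dotProduct (X : Matrix (Fin n) (Fin p) ℝ) (x₀ : Fin p → ℝ)
    (S : Finset (Fin p)) (v : Fin p → ℝ) :
    omegaExt X x₀ S ⬝ᵥ v = omegaS X x₀ S ⬝ᵥ outS S v :=
  extend_dotProduct _ _

theorem focusS_dotProduct (X : Matrix (Fin n) (Fin p) ℝ) (x₀ : Fin p → ℝ)
    (S : Finset (Fin p)) (v : Fin p → ℝ) :
    focusS X x₀ S ⬝ᵥ v = ((gramS X S)⁻¹ *ᵥ inS S x₀) ⬝ᵥ inS S v :=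
  extend_dotProduct _ _

/-- Rows in S undo the inverse of Σ_S and return x_{0,S}; rows outside S produce Σ_{10}Σ_S⁻¹x_{0,S},
which differs from x_{0,Sᶜ} by exactly ω_S. -/
theorem gram_mulVec_focusS {X : Matrix (Fin n) (Fin p) ℝ} (hX : (gram X).rank = p)
    (x₀ : Fin p → ℝ) (S : Finset (Fin p)) :
    gram X *ᵥ focusS X x₀ S = x₀ + omegaExt X x₀ S := by
  ext j
  rw [focusS, mulVec_extend]
  by_cases hj : j ∈ S
  · have h : (gramS X S *ᵥ ((gramS X S)⁻¹ *ᵥ inS S x₀)) ⟨j, hj⟩ = x₀ j := by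
      rw [Matrix.mulVec_mulVec, Matrix.mul_nonsing_inv _
        ((Matrix.isUnit_iff_isUnit_det _).1 (gramS_posDef hX S).isUnit), Matrix.one_mulVec]
      rfl
    simp only [Pi.add_apply, omegaExt, extend, hj, not_true, dite_false, add_zero]
    exact h
  · simp only [Pi.add_apply, omegaExt, extend, hj, not_false_eq_true, dite_true]
    simp only [omegaS, outS, Pi.sub_apply, add_sub_cancel]
    rfl

theorem omegaExt_ne_zero {X : Matrix (Fin n) (Fin p) ℝ} {x₀ : Fin p → ℝ} {S : Finset (Fin p)}
    (hω : omegaS X x₀ S ≠ 0) : omegaExt X x₀ S ≠ 0 := by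
  contrapose! hω
  ext j
  simpa [omegaExt, extend, j.2] using congrFun hω j

theorem quadOmega_eq (X : Matrix (Fin n) (Fin p) ℝ) (x₀ : Fin p → ℝ) (S : Finset (Fin p)) :
    quadOmega X x₀ S = omegaExt X x₀ S ⬝ᵥ ((gram X)⁻¹ *ᵥ omegaExt X x₀ S) := by
  rw [omegaExt_dotProduct, quadOmega]
  congr 1
  ext j
  simp only [outS]
  rw [omegaExt, mulVec_extend]
  rfl

theorem quadS_eq {X : Matrix (Fin n) (Fin p) ℝ} (hX : (gram X).rank = p) (x₀ : Fin p → ℝ)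
    (S : Finset (Fin p)) :
    quadS X x₀ S = focusS X x₀ S ⬝ᵥ (gram X *ᵥ focusS X x₀ S) := by
  have h : focusS X x₀ S ⬝ᵥ omegaExt X x₀ S = 0 := by
    rw [focusS_dotProduct, dotProduct]
    refine Finset.sum_eq_zero fun j _ => ?_
    simp [inS, omegaExt, extend, j.2]
  rw [gram_mulVec_focusS hX, dotProduct_add, h, add_zero, focusS_dotProduct, quadS,
    dotProduct_comm]

theorem gram_inv_mulVec_gram_mulVec {X : Matrix (Fin n) (Fin p) ℝ} (hX : (gram X).rank = p)
    (v : Fin p → ℝ) : (gram X)⁻¹ *ᵥ (gram X *ᵥ v) = v := by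
  rw [Matrix.mulVec_mulVec, Matrix.nonsing_inv_mul _
    ((Matrix.isUnit_iff_isUnit_det _).1 (gram_posDef hX).isUnit), Matrix.one_mulVec]

theorem gram_mulVec_gram_inv_mulVec {X : Matrix (Fin n) (Fin p) ℝ} (hX : (gram X).rank = p)
    (v : Fin p → ℝ) : gram X *ᵥ ((gram X)⁻¹ *ᵥ v) = v := by
  rw [Matrix.mulVec_mulVec, Matrix.mul_nonsing_inv _
    ((Matrix.isUnit_iff_isUnit_det _).1 (gram_posDef hX).isUnit), Matrix.one_mulVec]

theorem gram_mulVec_dotProduct (X : Matrix (Fin n) (Fin p) ℝ) (u v : Fin p → ℝ) :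
    (gram X *ᵥ u) ⬝ᵥ v = u ⬝ᵥ (gram X *ᵥ v) := by
  rw [Matrix.dotProduct_mulVec, ← Matrix.mulVec_transpose, gram_transpose]

/-- Pythagoras for the form Σ⁻¹ applied to x₀ = Σf - w: the cross term is f·w, zero by disjoint
supports. -/
theorem quadWide_eq_add {X : Matrix (Fin n) (Fin p) ℝ} (hX : (gram X).rank = p)
    (x₀ : Fin p → ℝ) (S : Finset (Fin p)) :
    quadWide X x₀ = quadS X x₀ S + quadOmega X x₀ S := by
  have hx : x₀ = gram X *ᵥ focusS X x₀ S - omegaExt X x₀ S := by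
    rw [gram_mulVec_focusS hX]; simp
  have h0 : focusS X x₀ S ⬝ᵥ omegaExt X x₀ S = 0 := by
    rw [focusS_dotProduct, dotProduct]
    refine Finset.sum_eq_zero fun j _ => ?_
    simp [inS, omegaExt, extend, j.2]
  have h1 : (gram X *ᵥ focusS X x₀ S) ⬝ᵥ ((gram X)⁻¹ *ᵥ omegaExt X x₀ S) = 0 := by
    rw [gram_mulVec_dotProduct, gram_mulVec_gram_inv_mulVec hX, h0]
  have h2 : omegaExt X x₀ S ⬝ᵥ focusS X x₀ S = 0 := by rw [dotProduct_comm, h0]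
  rw [quadWide, quadOmega_eq, quadS_eq hX]
  conv_lhs => rw [hx]
  rw [Matrix.mulVec_sub, gram_inv_mulVec_gram_mulVec hX, dotProduct_sub, sub_dotProduct,
    sub_dotProduct, h1, h2, dotProduct_comm (gram X *ᵥ _)]
  ring

theorem quadOmega_pos {X : Matrix (Fin n) (Fin p) ℝ} (hX : (gram X).rank = p)
    {x₀ : Fin p → ℝ} {S : Finset (Fin p)} (hω : omegaS X x₀ S ≠ 0) :
    0 < quadOmega X x₀ S := by
  rw [quadOmega_eq]
  simpa using (gram_posDef hX).inv.dotProduct_mulVec_pos (omegaExt_ne_zero hω)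

theorem quadS_nonneg {X : Matrix (Fin n) (Fin p) ℝ} (hX : (gram X).rank = p)
    (x₀ : Fin p → ℝ) (S : Finset (Fin p)) : 0 ≤ quadS X x₀ S := by
  rw [quadS]
  simpa using (gramS_posDef hX S).inv.posSemidef.dotProduct_mulVec_nonneg (inS S x₀)

/-- The coefficients `n⁻¹ X v` of the linear statistic `vᵗ n⁻¹ ∑ x_i y_i`. -/
noncomputable def coeff (X : Matrix (Fin n) (Fin p) ℝ) (v : Fin p → ℝ) : Fin n → ℝ :=
  (n : ℝ)⁻¹ • (X *ᵥ v)

theorem coeff_dotProduct (X : Matrix (Fin n) (Fin p) ℝ) (v : Fin p → ℝ) (y : Fin n → ℝ) :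
    coeff X v ⬝ᵥ y = v ⬝ᵥ ((n : ℝ)⁻¹ • (Xᵀ *ᵥ y)) := by
  rw [coeff, smul_dotProduct, dotProduct_smul, Matrix.dotProduct_mulVec, Matrix.vecMul_transpose]

theorem coeff_dotProduct_mulVec (X : Matrix (Fin n) (Fin p) ℝ) (v b : Fin p → ℝ) :
    coeff X v ⬝ᵥ (X *ᵥ b) = v ⬝ᵥ (gram X *ᵥ b) := by
  rw [coeff_dotProduct, gram_eq, Matrix.smul_mulVec, Matrix.mulVec_mulVec]

theorem coeff_dotProduct_coeff (X : Matrix (Fin n) (Fin p) ℝ) (v : Fin p → ℝ) :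
    coeff X v ⬝ᵥ coeff X v = (n : ℝ)⁻¹ * (v ⬝ᵥ (gram X *ᵥ v)) := by
  conv_lhs => rw [coeff.eq_1 X v, dotProduct_smul]
  rw [← coeff, coeff_dotProduct_mulVec, smul_eq_mul]

theorem dotProduct_betaHatWide (X : Matrix (Fin n) (Fin p) ℝ) (v : Fin p → ℝ) (y : Fin n → ℝ) :
    v ⬝ᵥ betaHatWide X y = coeff X ((gram X)⁻¹ *ᵥ v) ⬝ᵥ y := by
  rw [coeff_dotProduct, betaHatWide, sum_smul_row, Matrix.dotProduct_mulVec,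
    ← Matrix.mulVec_transpose, Matrix.transpose_nonsing_inv, gram_transpose]

theorem inS_dotProduct_betaHatS {X : Matrix (Fin n) (Fin p) ℝ} (x₀ : Fin p → ℝ)
    (S : Finset (Fin p)) (y : Fin n → ℝ) :
    inS S x₀ ⬝ᵥ betaHatS X S y = coeff X (focusS X x₀ S) ⬝ᵥ y := by
  have hT : (gramS X S)ᵀ = gramS X S := by
    ext i j
    exact congrFun (congrFun (gram_transpose X) i) j
  have hs : (n : ℝ)⁻¹ • ∑ i, y i • inS S (X i) = inS S ((n : ℝ)⁻¹ • (Xᵀ *ᵥ y)) := by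
    rw [← sum_smul_row]
    ext j
    simp [inS]
  rw [coeff_dotProduct, focusS_dotProduct, betaHatS, hs, Matrix.dotProduct_mulVec,
    ← Matrix.mulVec_transpose, Matrix.transpose_nonsing_inv, hT]

theorem transpose_mulVec_residual {X : Matrix (Fin n) (Fin p) ℝ} (hn : n ≠ 0)
    (hX : (gram X).rank = p) (y : Fin n → ℝ) :
    Xᵀ *ᵥ (y - X *ᵥ betaHatWide X y) = 0 := by
  have h : gram X *ᵥ betaHatWide X y = (n : ℝ)⁻¹ • (Xᵀ *ᵥ y) := by
    rw [betaHatWide, gram_mulVec_gram_inv_mulVec hX, sum_smul_row]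
  rw [gram_eq, Matrix.smul_mulVec, ← Matrix.mulVec_mulVec] at h
  have hn' : (n : ℝ)⁻¹ ≠ 0 := by positivity
  rw [Matrix.mulVec_sub, ← smul_right_injective _ hn' h, sub_self]

/-- The residual sum of squares is the sum of squares of `n - p` orthonormal linear functions
that annihilate the column space of the design matrix. -/
theorem exists_orthonormal_residual {X : Matrix (Fin n) (Fin p) ℝ} (hn : n ≠ 0)
    (hX : (gram X).rank = p) :
    ∃ a : Fin (n - p) → Fin n → ℝ, (∀ i j, a i ⬝ᵥ a j = if i = j then 1 else 0) ∧
      (∀ i v, a i ⬝ᵥ (X *ᵥ v) = 0) ∧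
      ∀ y, ∑ i, (y i - X i ⬝ᵥ betaHatWide X y) ^ 2 = ∑ j, (a j ⬝ᵥ y) ^ 2 := by
  -- `K` is the column space of the design; the required vectors are an orthonormal basis of its
  -- orthogonal complement.
  let K : Submodule ℝ (EuclideanSpace ℝ (Fin n)) :=
    (LinearMap.range X.mulVecLin).map (WithLp.linearEquiv 2 ℝ (Fin n → ℝ)).symm.toLinearMap
  have hK : Module.finrank ℝ Kᗮ = n - p := by
    have h1 : Module.finrank ℝ K = p := by
      rw [LinearEquiv.finrank_map_eq]
      exact gram_rank_design hX
    have h2 := K.finrank_add_finrank_orthogonal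
    rw [finrank_euclideanSpace_fin, h1] at h2
    omega
  let b := (stdOrthonormalBasis ℝ Kᗮ).reindex (finCongr hK)
  have hmem : ∀ v, (WithLp.toLp 2 (X *ᵥ v) : EuclideanSpace ℝ (Fin n)) ∈ K := fun v =>
    ⟨X *ᵥ v, ⟨v, rfl⟩, rfl⟩
  have hann : ∀ i v, (b i : EuclideanSpace ℝ (Fin n)).ofLp ⬝ᵥ (X *ᵥ v) = 0 := by
    intro i v
    have := (Submodule.mem_orthogonal _ _).1 (b i).2 _ (hmem v)
    rw [EuclideanSpace.inner_eq_star_dotProduct] at this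
    simpa using this
  refine ⟨fun i => (b i : EuclideanSpace ℝ (Fin n)).ofLp, fun i j => ?_, hann, fun y => ?_⟩
  · have := orthonormal_iff_ite.1 b.orthonormal j i
    rw [Submodule.coe_inner, EuclideanSpace.inner_eq_star_dotProduct] at this
    simp only [star_trivial] at this
    rw [this]
    simp [eq_comm]
  · set r := y - X *ᵥ betaHatWide X y with hr
    have hrK : (WithLp.toLp 2 r : EuclideanSpace ℝ (Fin n)) ∈ Kᗮ := by
      rw [Submodule.mem_orthogonal]
      rintro _ ⟨_, ⟨v, rfl⟩, rfl⟩
      rw [EuclideanSpace.inner_eq_star_dotProduct]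
      have h0 := transpose_mulVec_residual hn hX y
      rw [← hr] at h0
      simp only [star_trivial]
      change r ⬝ᵥ (X *ᵥ v) = 0
      rw [Matrix.dotProduct_mulVec, ← Matrix.mulVec_transpose, h0, zero_dotProduct]
    -- Parseval in `Kᗮ`, where the residual lives. The basis annihilates the fitted values, so the
    -- residual may then be replaced by `y`.
    have h := b.sum_sq_norm_inner_right ⟨_, hrK⟩
    have hy : ∀ j, (b j : EuclideanSpace ℝ (Fin n)).ofLp ⬝ᵥ y =
        (b j : EuclideanSpace ℝ (Fin n)).ofLp ⬝ᵥ r := by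
      intro j
      rw [hr, dotProduct_sub, hann, sub_zero]
    simp_rw [hy]
    have hL : ‖(⟨WithLp.toLp 2 r, hrK⟩ : Kᗮ)‖ ^ 2 = ∑ i, (r i) ^ 2 := by
      rw [Submodule.coe_norm, EuclideanSpace.real_norm_sq_eq]
    rw [hL] at h
    calc ∑ i, (y i - X i ⬝ᵥ betaHatWide X y) ^ 2 = ∑ i, r i ^ 2 := rfl
      _ = _ := h.symm
      _ = _ := by
        refine Finset.sum_congr rfl fun j _ => ?_
        rw [Submodule.coe_inner, EuclideanSpace.inner_eq_star_dotProduct]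
        simp [dotProduct_comm]

end FRIC

/-! ### Distribution functions of atomless laws -/

/-- The jump of a distribution function at a point is the mass of that point. -/
theorem continuous_cdf (μ : Measure ℝ) [IsProbabilityMeasure μ] [NullSingletonClass μ] :
    Continuous (cdf μ) := by
  refine continuous_iff_continuousAt.2 fun x => ?_
  have h : (cdf μ).measure {x} = 0 := by rw [measure_cdf, measure_singleton]
  rw [StieltjesFunction.measure_singleton, ENNReal.ofReal_eq_zero] at h
  have h2 := (monotone_cdf μ).leftLim_le (le_refl x)
  refine continuousAt_iff_continuous_left_right.2 ⟨?_, (cdf μ).right_continuous x⟩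
  rw [continuousWithinAt_Iio_iff_Iic.symm, (monotone_cdf μ).continuousWithinAt_Iio_iff_leftLim_eq]
  linarith

/-- The probability integral transform. -/
theorem measureReal_one_sub_cdf_le (μ : Measure ℝ) [IsProbabilityMeasure μ]
    [NullSingletonClass μ] {α : ℝ} (hα : α ∈ Set.Ioo (0 : ℝ) 1) :
    μ.real {x | 1 - cdf μ x ≤ α} = α := by
  have hc := continuous_cdf μ
  have hne : ({x | 1 - cdf μ x ≤ α} : Set ℝ).Nonempty := by
    obtain ⟨x, hx⟩ := ((tendsto_cdf_atTop μ).eventually_const_lt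
      (show 1 - α < 1 by linarith [hα.1])).exists
    exact ⟨x, show 1 - cdf μ x ≤ α by linarith⟩
  obtain ⟨b, hb⟩ := ((tendsto_cdf_atBot μ).eventually_lt_const
    (show 0 < 1 - α by linarith [hα.2])).exists
  have hbdd : BddBelow ({x | 1 - cdf μ x ≤ α} : Set ℝ) := by
    refine ⟨b, fun x hx => ?_⟩
    by_contra! h
    have := monotone_cdf μ h.le
    have hx' : 1 - cdf μ x ≤ α := hx
    linarith
  have hcl : IsClosed ({x | 1 - cdf μ x ≤ α} : Set ℝ) :=
    isClosed_le (by fun_prop) continuous_const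
  set q := sInf {x | 1 - cdf μ x ≤ α} with hq
  have hqm : 1 - cdf μ q ≤ α := hcl.csInf_mem hne hbdd
  have hset : {x | 1 - cdf μ x ≤ α} = Set.Ici q := by
    ext x
    refine ⟨fun hx => csInf_le hbdd hx, fun hx => ?_⟩
    have := monotone_cdf μ (show q ≤ x from hx)
    change 1 - cdf μ x ≤ α
    linarith
  -- Points left of `q` have distribution function below 1 - α; continuity passes this to `q`.
  -- Strict monotonicity is not needed.
  have hqe : cdf μ q = 1 - α := by
    refine le_antisymm ?_ (by linarith)
    refine le_of_tendsto (hc.continuousWithinAt (s := Set.Iio q) (x := q)) ?_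
    filter_upwards [self_mem_nhdsWithin] with x hx
    by_contra! h
    have : x ∈ Set.Ici q := hset ▸ (show 1 - cdf μ x ≤ α by linarith)
    exact absurd (show x < q from hx) (not_lt.2 this)
  rw [hset, ← Set.compl_Iio, probReal_compl_eq_one_sub measurableSet_Iio,
    measureReal_congr Iio_ae_eq_Iic, ← cdf_eq_real, hqe]
  ring

/-! ### Mass of symmetric intervals under shifted Gaussian laws -/

/-- The mass that `N(a, 1)` gives to `[-t, t]`, in terms of the standard normal distribution
function. -/
noncomputable def gaussianWindow (t a : ℝ) : ℝ :=
  cdf (gaussianReal 0 1) (t - a) - cdf (gaussianReal 0 1) (-t - a)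

instance nullSingletonClass_gaussianReal_one (k : ℝ) : NullSingletonClass (gaussianReal k 1) :=
  nullSingletonClass_gaussianReal one_ne_zero

theorem gaussianReal_real_Icc {t : ℝ} (ht : 0 ≤ t) (a : ℝ) :
    (gaussianReal a 1).real (Set.Icc (-t) t) = gaussianWindow t a := by
  have h : gaussianReal a 1 = (gaussianReal 0 1).map (· + a) := by
    rw [gaussianReal_map_add_const, zero_add]
  rw [h, map_measureReal_apply (by fun_prop) measurableSet_Icc, Set.preimage_add_const_Icc,
    measureReal_congr Ioc_ae_eq_Icc.symm, gaussianWindow, cdf_eq_real, cdf_eq_real,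
    ← Set.Iic_sdiff_Iic, measureReal_sdiff (Set.Iic_subset_Iic.2 (by linarith)) measurableSet_Iic]

theorem continuous_gaussianWindow : Continuous fun z : ℝ × ℝ => gaussianWindow z.1 z.2 := by
  have := continuous_cdf (gaussianReal 0 1)
  unfold gaussianWindow
  fun_prop

theorem gaussianWindow_nonneg {t : ℝ} (ht : 0 ≤ t) (a : ℝ) : 0 ≤ gaussianWindow t a := by
  rw [← gaussianReal_real_Icc ht]
  exact measureReal_nonneg

theorem gaussianWindow_le_one {t : ℝ} (ht : 0 ≤ t) (a : ℝ) : gaussianWindow t a ≤ 1 := by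
  rw [← gaussianReal_real_Icc ht]
  exact measureReal_le_one

/-- The complement of a bounded interval has positive Lebesgue measure, and Lebesgue measure is
absolutely continuous with respect to the Gaussian law. -/
theorem gaussianWindow_lt_one {t : ℝ} (ht : 0 ≤ t) (a : ℝ) : gaussianWindow t a < 1 := by
  rw [← gaussianReal_real_Icc ht]
  have h : 0 < (gaussianReal a 1).real (Set.Icc (-t) t)ᶜ := by
    rw [measureReal_def, ENNReal.toReal_pos_iff]
    refine ⟨?_, measure_lt_top _ _⟩
    rw [pos_iff_ne_zero]
    intro h0
    have h1 := gaussianReal_absolutelyContinuous' a one_ne_zero h0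
    have h2 : volume (Set.Ioi t) = 0 := measure_mono_null
      (fun x hx => fun hx' => absurd hx'.2 (not_le.2 hx)) h1
    simp at h2
  rw [probReal_compl_eq_one_sub measurableSet_Icc] at h
  linarith

theorem tendsto_gaussianWindow {t : ℝ} (ht : 0 ≤ t) :
    Tendsto (gaussianWindow t) atTop (𝓝 0) := by
  have h : Tendsto (fun a : ℝ => cdf (gaussianReal 0 1) (t - a)) atTop (𝓝 0) :=
    (tendsto_cdf_atBot _).comp
      (tendsto_atBot_add_const_left atTop t tendsto_neg_atTop_atBot)
  refine squeeze_zero (gaussianWindow_nonneg ht) (fun a => ?_) h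
  have := cdf_nonneg (gaussianReal 0 1) (-t - a)
  unfold gaussianWindow
  linarith

theorem cdf_gaussianReal_sub_eq_integral {a b : ℝ} (h : a ≤ b) :
    cdf (gaussianReal 0 1) b - cdf (gaussianReal 0 1) a =
      ∫ x in a..b, gaussianPDFReal 0 1 x := by
  rw [intervalIntegral.integral_of_le h, cdf_eq_real, cdf_eq_real,
    ← measureReal_sdiff (Set.Iic_subset_Iic.2 h) measurableSet_Iic, Set.Iic_sdiff_Iic,
    measureReal_def, gaussianReal_apply_eq_integral _ one_ne_zero, ENNReal.toReal_ofReal]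
  exact integral_nonneg fun x => gaussianPDFReal_nonneg _ _ _

theorem gaussianPDFReal_le_of_abs_le {x y : ℝ} (h : |x| ≤ |y|) :
    gaussianPDFReal 0 1 y ≤ gaussianPDFReal 0 1 x := by
  have := sq_le_sq.2 h
  simp only [gaussianPDFReal, sub_zero, NNReal.coe_one, mul_one]
  gcongr

theorem gaussianPDFReal_zero_neg (x : ℝ) :
    gaussianPDFReal 0 1 (-x) = gaussianPDFReal 0 1 x := by
  simp [gaussianPDFReal]

/-- Moving the centre from a to b trades a strip at one end of the window for one at the other.
Reflections carry both strips to [t + a, t + b], with integrands φ(2t - x) for the lost mass and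
φ(x) for the gained mass; there |2t - x| ≤ |x|. -/
theorem antitoneOn_gaussianWindow {t : ℝ} (ht : 0 ≤ t) :
    AntitoneOn (gaussianWindow t) (Set.Ici 0) := by
  intro a ha b hb hab
  have ha' : 0 ≤ a := ha
  have h1 := cdf_gaussianReal_sub_eq_integral (show t - b ≤ t - a by linarith)
  have h2 := cdf_gaussianReal_sub_eq_integral (show -t - b ≤ -t - a by linarith)
  have e1 : ∫ x in (t - b)..(t - a), gaussianPDFReal 0 1 x =
      ∫ x in (t + a)..(t + b), gaussianPDFReal 0 1 (2 * t - x) := by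
    rw [intervalIntegral.integral_comp_sub_left (fun x => gaussianPDFReal 0 1 x)]
    congr 1 <;> ring
  have e2 : ∫ x in (-t - b)..(-t - a), gaussianPDFReal 0 1 x =
      ∫ x in (t + a)..(t + b), gaussianPDFReal 0 1 x := by
    have := intervalIntegral.integral_comp_neg (a := t + a) (b := t + b)
      (fun x => gaussianPDFReal 0 1 x)
    simp_rw [gaussianPDFReal_zero_neg] at this
    rw [this]
    congr 1 <;> ring
  have hi := integrable_gaussianPDFReal 0 1
  have hle : ∫ x in (t + a)..(t + b), gaussianPDFReal 0 1 x ≤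
      ∫ x in (t + a)..(t + b), gaussianPDFReal 0 1 (2 * t - x) := by
    refine intervalIntegral.integral_mono_on (by linarith) hi.intervalIntegrable
      (hi.comp_sub_left (2 * t)).intervalIntegrable fun x hx => ?_
    refine gaussianPDFReal_le_of_abs_le (abs_le_abs ?_ ?_) <;> linarith [hx.1]
  unfold gaussianWindow
  linarith

/-! ### The noncentral chi-squared and `F` distributions -/

instance isProbabilityMeasure_chiSquared (m : ℕ) : IsProbabilityMeasure (chiSquared m) :=
  Measure.isProbabilityMeasure_map (Measurable.aemeasurable (by fun_prop))

instance isProbabilityMeasure_noncentralChiSquared (d : ℕ) (lam : ℝ) :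
    IsProbabilityMeasure (noncentralChiSquared d lam) :=
  Measure.isProbabilityMeasure_map (Measurable.aemeasurable (by fun_prop))

instance isProbabilityMeasure_noncentralF (d m : ℕ) (lam : ℝ) :
    IsProbabilityMeasure (noncentralF d m lam) :=
  Measure.isProbabilityMeasure_map (Measurable.aemeasurable (by fun_prop))

theorem ae_chiSquared_pos {m : ℕ} (hm : m ≠ 0) : ∀ᵐ v ∂(chiSquared m), 0 < v := by
  rw [chiSquared, ae_map_iff (Measurable.aemeasurable (by fun_prop)) measurableSet_Ioi]
  have := Measure.ae_eval_ne (μ := fun _ : Fin m => gaussianReal 0 1) ⟨0, by omega⟩ (0 : ℝ)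
  filter_upwards [this] with z hz
  exact Finset.sum_pos' (fun i _ => sq_nonneg _) ⟨⟨0, by omega⟩, Finset.mem_univ _, by positivity⟩

theorem noncentralChiSquared_one (lam : ℝ) :
    noncentralChiSquared 1 lam = (gaussianReal (√lam) 1).map fun z => z ^ 2 := by
  have h := (measurePreserving_piUnique
    (fun i : Fin 1 => gaussianReal (if i.val = 0 then √lam else 0) 1)).map_eq
  simp only [Fin.default_eq_zero, Fin.val_zero, if_true] at h
  rw [← h, Measure.map_map (by fun_prop) (by fun_prop), noncentralChiSquared]
  congr 1
  ext z
  simp [MeasurableEquiv.piUnique]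

theorem noncentralF_one (m : ℕ) (lam : ℝ) :
    noncentralF 1 m lam =
      ((gaussianReal (√lam) 1).prod (chiSquared m)).map
        fun z : ℝ × ℝ => z.1 ^ 2 / (z.2 / m) := by
  have h := Measure.map_prod_map (gaussianReal (√lam) 1) (chiSquared m)
    (f := fun z => z ^ 2) (g := id) (by fun_prop) measurable_id
  rw [Measure.map_id] at h
  rw [noncentralF, noncentralChiSquared_one, h, Measure.map_map (by fun_prop) (by fun_prop)]
  congr 1
  ext z
  simp

/-- Reflection symmetry: the noncentral chi-squared law is built from the nonnegative mean √λ, while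
κ may have either sign. -/
theorem map_sq_gaussianReal_abs (k : ℝ) :
    (gaussianReal (√(k ^ 2)) 1).map (fun z => z ^ 2) = (gaussianReal k 1).map fun z => z ^ 2 := by
  rw [Real.sqrt_sq_eq_abs]
  rcases abs_choice k with h | h
  · rw [h]
  · rw [h, ← gaussianReal_map_neg, Measure.map_map (by fun_prop) (by fun_prop)]
    congr 1
    ext z
    simp

theorem noncentralT_map_sq (m : ℕ) (k : ℝ) :
    (noncentralT m k).map (fun x => x ^ 2) = noncentralF 1 m (k ^ 2) := by
  -- Needed because `Real.sqrt` vanishes on negative arguments, so squaring recovers V/m only where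
  -- V ≥ 0.
  have hV : ∀ᵐ z ∂((gaussianReal k 1).prod (chiSquared m)), 0 ≤ z.2 := by
    have h0 : ∀ᵐ v ∂(chiSquared m), 0 ≤ v := by
      rw [chiSquared, ae_map_iff (Measurable.aemeasurable (by fun_prop)) measurableSet_Ici]
      exact ae_of_all _ fun z => Finset.sum_nonneg fun i _ => sq_nonneg _
    exact Measure.quasiMeasurePreserving_snd.ae h0
  have h := Measure.map_prod_map (gaussianReal k 1) (chiSquared m)
    (f := fun z => z ^ 2) (g := id) (by fun_prop) measurable_id
  rw [Measure.map_id] at h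
  rw [noncentralF, noncentralChiSquared_one, map_sq_gaussianReal_abs, h, noncentralT,
    Measure.map_map (by fun_prop) (by fun_prop), Measure.map_map (by fun_prop) (by fun_prop)]
  refine Measure.map_congr ?_
  filter_upwards [hV] with z hz
  have h1 : √(z.2 / m) ^ 2 = z.2 / m := Real.sq_sqrt (by positivity)
  simp only [Function.comp, Prod.map, id, div_pow, h1, Nat.cast_one, div_one]

theorem noncentralF_zero (m : ℕ) : noncentralF 1 m 0 = centralF 1 m := by
  have : noncentralChiSquared 1 0 = chiSquared 1 := by
    simp [noncentralChiSquared, chiSquared]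
  rw [noncentralF, centralF, this]

theorem nullSingletonClass_noncentralF {m : ℕ} (hm : m ≠ 0) (lam : ℝ) :
    NullSingletonClass (noncentralF 1 m lam) := by
  refine ⟨fun x => ?_⟩
  rw [noncentralF_one, Measure.map_apply (by fun_prop) (measurableSet_singleton x),
    Measure.prod_apply_symm
      ((show Measurable fun z : ℝ × ℝ => z.1 ^ 2 / (z.2 / m) by fun_prop)
        (measurableSet_singleton x)), lintegral_eq_zero_iff']
  · filter_upwards [ae_chiSquared_pos hm] with v hv
    -- Given V = v > 0, at most two values of the normal variable make the ratio equal to `x`.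
    refine measure_mono_null (t := {√(x * (v / m)), -√(x * (v / m))}) (fun z hz => ?_)
      (Set.Finite.measure_zero (by simp) _)
    have hz' : z ^ 2 / (v / m) = x := hz
    have hm' : (0 : ℝ) < m := by positivity
    rw [div_eq_iff (by positivity)] at hz'
    rw [Set.mem_insert_iff, Set.mem_singleton_iff, ← hz', Real.sqrt_sq_eq_abs]
    rcases abs_choice z with h | h <;> rw [h] <;> simp
  · exact (measurable_measure_prodMk_right
      ((show Measurable fun z : ℝ × ℝ => z.1 ^ 2 / (z.2 / m) by fun_prop)
        (measurableSet_singleton x))).aemeasurable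

/-- Given V = v > 0, the event is |N| ≤ √(xv/m). All dependence on λ is thereby placed in the centre
√λ of a Gaussian, where monotonicity, continuity and limits can be read off under the integral. -/
theorem cdf_noncentralF {m : ℕ} (hm : m ≠ 0) (lam : ℝ) {x : ℝ} (hx : 0 ≤ x) :
    cdf (noncentralF 1 m lam) x =
      ∫ v, gaussianWindow (√(x * (v / m))) (√lam) ∂(chiSquared m) := by
  have hS : MeasurableSet ((fun z : ℝ × ℝ => z.1 ^ 2 / (z.2 / m)) ⁻¹' Set.Iic x) :=
    (show Measurable fun z : ℝ × ℝ => z.1 ^ 2 / (z.2 / m) by fun_prop) measurableSet_Iic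
  rw [cdf_eq_real, measureReal_def, noncentralF_one, Measure.map_apply (by fun_prop)
    measurableSet_Iic, Measure.prod_apply_symm hS, ← integral_toReal]
  · refine integral_congr_ae ?_
    filter_upwards [ae_chiSquared_pos hm] with v hv
    rw [← gaussianReal_real_Icc (Real.sqrt_nonneg _), measureReal_def]
    congr 2
    ext z
    have hm' : (0 : ℝ) < m := by positivity
    simp only [Set.mem_preimage, Set.mem_Iic, Set.mem_Icc]
    rw [div_le_iff₀ (by positivity), ← abs_le, ← Real.sqrt_le_sqrt_iff (by positivity),
      Real.sqrt_sq_eq_abs]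
  · exact (measurable_measure_prodMk_right hS).aemeasurable
  · exact ae_of_all _ fun v => measure_lt_top _ _

theorem aestronglyMeasurable_gaussianWindow (μ : Measure ℝ) (m : ℕ) (a x : ℝ) :
    AEStronglyMeasurable (fun v => gaussianWindow (√(x * (v / m))) a) μ :=
  (continuous_gaussianWindow.comp
    (show Continuous fun v : ℝ => (√(x * (v / m)), a) by fun_prop)).aestronglyMeasurable

theorem norm_gaussianWindow_le (x v a : ℝ) : ‖gaussianWindow (√(x * v)) a‖ ≤ 1 := by
  rw [Real.norm_of_nonneg (gaussianWindow_nonneg (Real.sqrt_nonneg _) _)]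
  exact gaussianWindow_le_one (Real.sqrt_nonneg _) _

theorem integrable_gaussianWindow (m : ℕ) (a x : ℝ) :
    Integrable (fun v => gaussianWindow (√(x * (v / m))) a) (chiSquared m) :=
  Integrable.of_bound (aestronglyMeasurable_gaussianWindow _ _ _ _) 1
    (ae_of_all _ fun _ => norm_gaussianWindow_le _ _ _)

/-- Holds on the whole line, since √λ = 0 for negative λ. -/
theorem antitone_cdf_noncentralF {m : ℕ} (hm : m ≠ 0) {x : ℝ} (hx : 0 ≤ x) :
    Antitone fun lam => cdf (noncentralF 1 m lam) x := by
  intro a b hab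
  simp only [cdf_noncentralF hm _ hx]
  refine integral_mono (integrable_gaussianWindow _ _ _) (integrable_gaussianWindow _ _ _)
    fun v => ?_
  exact antitoneOn_gaussianWindow (Real.sqrt_nonneg _) (Real.sqrt_nonneg a) (Real.sqrt_nonneg b)
    (Real.sqrt_le_sqrt hab)

theorem continuous_cdf_noncentralF {m : ℕ} (hm : m ≠ 0) {x : ℝ} (hx : 0 ≤ x) :
    Continuous fun lam => cdf (noncentralF 1 m lam) x := by
  simp only [cdf_noncentralF hm _ hx]
  refine continuous_of_dominated (bound := fun _ => 1)
    (fun a => aestronglyMeasurable_gaussianWindow _ _ _ _)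
    (fun a => ae_of_all _ fun v => norm_gaussianWindow_le _ _ _) (integrable_const _)
    (ae_of_all _ fun v => ?_)
  exact continuous_gaussianWindow.comp
    (show Continuous fun a : ℝ => (√(x * (v / m)), √a) by fun_prop)

theorem tendsto_cdf_noncentralF {m : ℕ} (hm : m ≠ 0) {x : ℝ} (hx : 0 ≤ x) :
    Tendsto (fun lam => cdf (noncentralF 1 m lam) x) atTop (𝓝 0) := by
  simp only [cdf_noncentralF hm _ hx]
  rw [show (0 : ℝ) = ∫ _, 0 ∂(chiSquared m) by simp]
  refine tendsto_integral_filter_of_dominated_convergence (fun _ => 1)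
    (Eventually.of_forall fun a => aestronglyMeasurable_gaussianWindow _ _ _ _)
    (Eventually.of_forall fun a => ae_of_all _ fun v => norm_gaussianWindow_le _ _ _)
    (integrable_const _) (ae_of_all _ fun v => ?_)
  exact (tendsto_gaussianWindow (Real.sqrt_nonneg _)).comp Real.tendsto_sqrt_atTop

theorem cdf_noncentralF_lt_one {m : ℕ} (hm : m ≠ 0) (lam : ℝ) {x : ℝ} (hx : 0 ≤ x) :
    cdf (noncentralF 1 m lam) x < 1 := by
  rw [cdf_noncentralF hm _ hx]
  have hpos : 0 < ∫ v, (1 - gaussianWindow (√(x * (v / m))) (√lam)) ∂(chiSquared m) := by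
    have hlt : ∀ v : ℝ, 0 < 1 - gaussianWindow (√(x * (v / m))) (√lam) := fun v =>
      sub_pos.2 (gaussianWindow_lt_one (Real.sqrt_nonneg _) _)
    rw [integral_pos_iff_support_of_nonneg (fun v => (hlt v).le)
      ((integrable_const _).sub (integrable_gaussianWindow _ _ _))]
    have : Function.support (fun v => 1 - gaussianWindow (√(x * (v / m))) (√lam)) = Set.univ :=
      Set.eq_univ_of_forall fun v => (hlt v).ne'
    rw [this]
    simp
  rw [integral_sub (integrable_const _) (integrable_gaussianWindow _ _ _)] at hpos
  simpa using hpos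

/-! ### Joint laws of orthonormal linear statistics -/

/-- Stacking `c` on top of the `a j` gives a matrix with m + 1 orthonormal rows; its image of the
Gaussian vector is again standard, and splitting off the first coordinate gives the independence. -/
theorem pi_gaussianReal_map_dotProduct_sum_sq {κ : Type*} [Fintype κ] {m : ℕ} (c : κ → ℝ)
    (a : Fin m → κ → ℝ) (hc : c ⬝ᵥ c = 1) (hca : ∀ j, c ⬝ᵥ a j = 0)
    (ha : ∀ i j, a i ⬝ᵥ a j = if i = j then 1 else 0) :
    (Measure.pi fun _ : κ => gaussianReal 0 1).map
        (fun z => (c ⬝ᵥ z, ∑ j, (a j ⬝ᵥ z) ^ 2)) =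
      (gaussianReal 0 1).prod (chiSquared m) := by
  let A : Matrix (Fin (m + 1)) κ ℝ := Matrix.of (Fin.cons c a)
  have hA : A * Aᵀ = 1 := by
    ext i j
    change (Fin.cons c a : Fin (m + 1) → κ → ℝ) i ⬝ᵥ (Fin.cons c a : Fin (m + 1) → κ → ℝ) j = _
    refine Fin.cases ?_ (fun i => ?_) i <;> refine Fin.cases ?_ (fun j => ?_) j
    · simpa using hc
    · simpa [Matrix.one_apply, (Fin.succ_ne_zero j).symm] using hca j
    · simpa [Matrix.one_apply, dotProduct_comm] using hca i
    · simpa [Matrix.one_apply] using ha i j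
  have h1 := pi_gaussianReal_map_mulVec A hA
  have h2 := (measurePreserving_piFinSuccAbove (fun _ : Fin (m + 1) => gaussianReal 0 1) 0).map_eq
  have h3 := Measure.map_prod_map (gaussianReal 0 1) (Measure.pi fun _ : Fin m => gaussianReal 0 1)
    (f := id) (g := fun z => ∑ i, z i ^ 2) measurable_id (by fun_prop)
  rw [Measure.map_id] at h3
  have hm : Measurable fun z : κ → ℝ => A *ᵥ z :=
    (Continuous.matrix_mulVec continuous_const continuous_id).measurable
  rw [chiSquared, h3, ← h2, ← h1, Measure.map_map (by fun_prop) hm,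
    Measure.map_map (Measurable.prodMap measurable_id (by fun_prop)) (by fun_prop)]
  rfl

theorem noncentralT_eq_map (m : ℕ) (k : ℝ) :
    noncentralT m k = ((gaussianReal 0 1).prod (chiSquared m)).map
      fun z : ℝ × ℝ => (k + z.1) / √(z.2 / m) := by
  have h : gaussianReal k 1 = (gaussianReal 0 1).map (k + ·) := by
    rw [gaussianReal_map_const_add, zero_add]
  have h3 := Measure.map_prod_map (gaussianReal 0 1) (chiSquared m)
    (f := (k + ·)) (g := id) (by fun_prop) measurable_id
  rw [Measure.map_id] at h3
  rw [noncentralT, h, h3, Measure.map_map (by fun_prop) (by fun_prop)]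
  rfl

namespace FRIC

variable {n p : ℕ}

/-! ### The law of the statistic and the relative risk -/

theorem model_eq_map (X : Matrix (Fin n) (Fin p) ℝ) (β : Fin p → ℝ) (σ : ℝ) :
    model X β σ = (Measure.pi fun _ : Fin n => gaussianReal 0 1).map
      fun z => X *ᵥ β + σ • z := by
  have h : (Measure.pi fun _ : Fin n => gaussianReal 0 (σ ^ 2).toNNReal) =
      (Measure.pi fun _ : Fin n => gaussianReal 0 1).map fun z i => σ * z i := by
    rw [Measure.pi_map_pi (f := fun _ x => σ * x) (fun i => by fun_prop)]
    simp only [gaussianReal_map_const_mul, mul_zero, mul_one]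
    congr! 3
    exact Real.toNNReal_of_nonneg (sq_nonneg σ)
  rw [model, h, Measure.map_map (by fun_prop) (by fun_prop)]
  rfl

theorem mse_linear (X : Matrix (Fin n) (Fin p) ℝ) (x₀ β : Fin p → ℝ) (σ : ℝ) (c : Fin n → ℝ) :
    mse X x₀ β σ (fun y => c ⬝ᵥ y) =
      (c ⬝ᵥ (X *ᵥ β) - x₀ ⬝ᵥ β) ^ 2 + σ ^ 2 * (c ⬝ᵥ c) := by
  rw [mse, model_eq_map, integral_map (Measurable.aemeasurable (by fun_prop))
    (Measurable.aestronglyMeasurable (by simp only [dotProduct]; fun_prop)),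
    ← integral_sq_affine_pi_gaussianReal]
  congr 1
  ext z
  rw [dotProduct_add, dotProduct_smul, smul_eq_mul]
  ring

theorem mse_wide_eq {X : Matrix (Fin n) (Fin p) ℝ} (hX : (gram X).rank = p)
    (x₀ β : Fin p → ℝ) (σ : ℝ) :
    mse X x₀ β σ (fun y => x₀ ⬝ᵥ betaHatWide X y) = σ ^ 2 * ((n : ℝ)⁻¹ * quadWide X x₀) := by
  simp_rw [dotProduct_betaHatWide]
  rw [mse_linear, coeff_dotProduct_mulVec, coeff_dotProduct_coeff, ← gram_mulVec_dotProduct,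
    gram_mulVec_gram_inv_mulVec hX, quadWide, dotProduct_comm _ x₀]
  ring

theorem mse_submodel_eq {X : Matrix (Fin n) (Fin p) ℝ} (hX : (gram X).rank = p)
    (x₀ : Fin p → ℝ) (S : Finset (Fin p)) (β : Fin p → ℝ) (σ : ℝ) :
    mse X x₀ β σ (fun y => inS S x₀ ⬝ᵥ betaHatS X S y) =
      (omegaS X x₀ S ⬝ᵥ outS S β) ^ 2 + σ ^ 2 * ((n : ℝ)⁻¹ * quadS X x₀ S) := by
  simp_rw [inS_dotProduct_betaHatS]
  rw [mse_linear, coeff_dotProduct_mulVec, coeff_dotProduct_coeff, ← quadS_eq hX,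
    ← gram_mulVec_dotProduct, gram_mulVec_focusS hX, add_dotProduct, omegaExt_dotProduct]
  ring

theorem quadWide_pos {X : Matrix (Fin n) (Fin p) ℝ} (hX : (gram X).rank = p)
    {x₀ : Fin p → ℝ} {S : Finset (Fin p)} (hω : omegaS X x₀ S ≠ 0) : 0 < quadWide X x₀ := by
  have h1 := quadOmega_pos hX hω
  have h2 := quadS_nonneg hX x₀ S
  rw [quadWide_eq_add hX x₀ S]
  linarith

/-- Scaling both mean squared errors by n/σ² turns the squared bias into ω_SᵀQ_Sω_S κ²; this is what
the normalisation of κ is for. -/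
theorem quadWide_mul_rr {X : Matrix (Fin n) (Fin p) ℝ} (hn : n ≠ 0) (hX : (gram X).rank = p)
    {x₀ : Fin p → ℝ} {S : Finset (Fin p)} (hω : omegaS X x₀ S ≠ 0) (β : Fin p → ℝ) {σ : ℝ}
    (hσ : 0 < σ) :
    quadWide X x₀ * rr X x₀ S β σ = quadS X x₀ S + quadOmega X x₀ S * kappa X x₀ S β σ ^ 2 := by
  have hW := quadWide_pos hX hω
  have hΩ := quadOmega_pos hX hω
  have hn' : (n : ℝ) ≠ 0 := by exact_mod_cast hn
  rw [rr, mse_wide_eq hX, mse_submodel_eq hX, kappa, div_pow, mul_pow, mul_pow,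
    Real.sq_sqrt (Nat.cast_nonneg n), Real.sq_sqrt hΩ.le]
  field_simp
  ring

theorem noncentrality_rr {X : Matrix (Fin n) (Fin p) ℝ} (hn : n ≠ 0) (hX : (gram X).rank = p)
    {x₀ : Fin p → ℝ} {S : Finset (Fin p)} (hω : omegaS X x₀ S ≠ 0) (β : Fin p → ℝ) {σ : ℝ}
    (hσ : 0 < σ) :
    (quadWide X x₀ * rr X x₀ S β σ - quadS X x₀ S) / quadOmega X x₀ S =
      kappa X x₀ S β σ ^ 2 := by
  have hΩ := quadOmega_pos hX hω
  rw [quadWide_mul_rr hn hX hω β hσ]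
  field_simp
  ring

theorem rrMin_le_rr {X : Matrix (Fin n) (Fin p) ℝ} (hn : n ≠ 0) (hX : (gram X).rank = p)
    {x₀ : Fin p → ℝ} {S : Finset (Fin p)} (hω : omegaS X x₀ S ≠ 0) (β : Fin p → ℝ) {σ : ℝ}
    (hσ : 0 < σ) : rrMin X x₀ S ≤ rr X x₀ S β σ := by
  rw [rrMin, div_le_iff₀ (quadWide_pos hX hω), mul_comm, quadWide_mul_rr hn hX hω β hσ]
  have := quadOmega_pos hX hω
  nlinarith [mul_nonneg this.le (sq_nonneg (kappa X x₀ S β σ))]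

theorem measurable_kappaHat {X : Matrix (Fin n) (Fin p) ℝ} (hn : n ≠ 0)
    (hX : (gram X).rank = p) (x₀ : Fin p → ℝ) (S : Finset (Fin p)) :
    Measurable (kappaHat X x₀ S) := by
  obtain ⟨a, -, -, h⟩ := exists_orthonormal_residual hn hX
  unfold kappaHat sigmaHatSq
  simp_rw [h, ← omegaExt_dotProduct, dotProduct_betaHatWide, dotProduct]
  fun_prop

theorem hasLaw_kappaHat {X : Matrix (Fin n) (Fin p) ℝ} (hpn : p < n) (hX : (gram X).rank = p)
    {x₀ : Fin p → ℝ} {S : Finset (Fin p)} (hω : omegaS X x₀ S ≠ 0) (β : Fin p → ℝ) {σ : ℝ}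
    (hσ : 0 < σ) :
    HasLaw (kappaHat X x₀ S) (noncentralT (n - p) (kappa X x₀ S β σ)) (model X β σ) := by
  have hn : n ≠ 0 := by omega
  have hn' : (0 : ℝ) < n := by positivity
  have hΩ := quadOmega_pos hX hω
  obtain ⟨a, ha, hann, hres⟩ := exists_orthonormal_residual hn hX
  set w := omegaExt X x₀ S with hw
  set c := coeff X ((gram X)⁻¹ *ᵥ w) with hc
  -- Since c·c = n⁻¹ω_SᵀQ_Sω_S, this factor makes `s • c` a unit vector. It lies in the column
  -- space, hence is orthogonal to every `a j`.
  set s := √(n : ℝ) / √(quadOmega X x₀ S) with hs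
  have hsc : (s • c) ⬝ᵥ (s • c) = 1 := by
    rw [smul_dotProduct, dotProduct_smul, hc, coeff_dotProduct_coeff,
      gram_mulVec_gram_inv_mulVec hX, dotProduct_comm, ← quadOmega_eq, smul_eq_mul, smul_eq_mul,
      ← mul_assoc, ← sq, hs, div_pow, Real.sq_sqrt hn'.le, Real.sq_sqrt hΩ.le]
    field_simp
  have hsa : ∀ j, (s • c) ⬝ᵥ a j = 0 := by
    intro j
    rw [smul_dotProduct, dotProduct_comm, hc, coeff, dotProduct_smul, hann, smul_zero, smul_zero]
  have hcβ : c ⬝ᵥ (X *ᵥ β) = omegaS X x₀ S ⬝ᵥ outS S β := by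
    rw [hc, coeff_dotProduct_mulVec, ← gram_mulVec_dotProduct, gram_mulVec_gram_inv_mulVec hX,
      hw, omegaExt_dotProduct]
  refine ⟨(measurable_kappaHat hn hX x₀ S).aemeasurable, ?_⟩
  rw [model_eq_map, Measure.map_map (measurable_kappaHat hn hX x₀ S) (by fun_prop),
    noncentralT_eq_map, ← pi_gaussianReal_map_dotProduct_sum_sq (s • c) a hsc hsa ha,
    Measure.map_map (by fun_prop) (by simp only [dotProduct]; fun_prop)]
  -- The two maps agree at every point, not just almost surely: where σ̂ = 0 both quotients are 0 by
  -- the division convention. Elsewhere σ cancels.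
  congr 1
  ext z
  simp only [Function.comp]
  rw [kappaHat, sigmaHatSq, hres, ← omegaExt_dotProduct, dotProduct_betaHatWide, ← hw, ← hc,
    dotProduct_add, hcβ]
  have h1 : ∀ j, a j ⬝ᵥ (X *ᵥ β + σ • z) = σ * (a j ⬝ᵥ z) := by
    intro j
    rw [dotProduct_add, hann, zero_add, dotProduct_smul, smul_eq_mul]
  have h2 : ((n : ℝ) - p)⁻¹ * ∑ j, (a j ⬝ᵥ (X *ᵥ β + σ • z)) ^ 2 =
      σ ^ 2 * ((∑ j, (a j ⬝ᵥ z) ^ 2) / ((n - p : ℕ) : ℝ)) := by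
    simp_rw [h1, mul_pow]
    rw [← Finset.mul_sum, Nat.cast_sub hpn.le]
    ring
  rw [h2, Real.sqrt_mul (sq_nonneg σ), Real.sqrt_sq hσ.le, dotProduct_smul, smul_dotProduct,
    smul_eq_mul, smul_eq_mul, kappa, hs]
  have hq : √(quadOmega X x₀ S) ≠ 0 := (Real.sqrt_pos.2 hΩ).ne'
  field_simp

theorem hasLaw_kappaHat_sq {X : Matrix (Fin n) (Fin p) ℝ} (hpn : p < n)
    (hX : (gram X).rank = p) {x₀ : Fin p → ℝ} {S : Finset (Fin p)} (hω : omegaS X x₀ S ≠ 0)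
    (β : Fin p → ℝ) {σ : ℝ} (hσ : 0 < σ) :
    HasLaw (fun y => kappaHat X x₀ S y ^ 2) (noncentralF 1 (n - p) (kappa X x₀ S β σ ^ 2))
      (model X β σ) :=
  HasLaw.fun_comp (Y := fun x : ℝ => x ^ 2) ⟨by fun_prop, noncentralT_map_sq _ _⟩
    (hasLaw_kappaHat hpn hX hω β hσ)

/-! ### The confidence distribution -/

theorem noncentrality_rrMin {X : Matrix (Fin n) (Fin p) ℝ} (hX : (gram X).rank = p)
    {x₀ : Fin p → ℝ} {S : Finset (Fin p)} (hω : omegaS X x₀ S ≠ 0) :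
    (quadWide X x₀ * rrMin X x₀ S - quadS X x₀ S) / quadOmega X x₀ S = 0 := by
  rw [rrMin, mul_div_cancel₀ _ (quadWide_pos hX hω).ne', sub_self, zero_div]

theorem rrMin_le_one {X : Matrix (Fin n) (Fin p) ℝ} (hX : (gram X).rank = p)
    {x₀ : Fin p → ℝ} {S : Finset (Fin p)} (hω : omegaS X x₀ S ≠ 0) : rrMin X x₀ S ≤ 1 := by
  rw [rrMin, div_le_one (quadWide_pos hX hω), quadWide_eq_add hX x₀ S]
  linarith [quadOmega_pos hX hω]

theorem confDist_of_le {X : Matrix (Fin n) (Fin p) ℝ} {x₀ : Fin p → ℝ} {S : Finset (Fin p)}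
    {r : ℝ} (hr : rrMin X x₀ S ≤ r) (y : Fin n → ℝ) :
    confDist X x₀ S r y =
      1 - cdf (noncentralF 1 (n - p) ((quadWide X x₀ * r - quadS X x₀ S) / quadOmega X x₀ S))
        (kappaHat X x₀ S y ^ 2) :=
  if_pos hr

theorem confDist_of_lt {X : Matrix (Fin n) (Fin p) ℝ} {x₀ : Fin p → ℝ} {S : Finset (Fin p)}
    {r : ℝ} (hr : r < rrMin X x₀ S) (y : Fin n → ℝ) : confDist X x₀ S r y = 0 :=
  if_neg (not_le.2 hr)

theorem confDist_nonneg (X : Matrix (Fin n) (Fin p) ℝ) (x₀ : Fin p → ℝ) (S : Finset (Fin p))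
    (r : ℝ) (y : Fin n → ℝ) : 0 ≤ confDist X x₀ S r y := by
  unfold confDist
  split_ifs
  · exact sub_nonneg.2 (cdf_le_one _ _)
  · exact le_rfl

theorem isDistributionFunction_confDist {X : Matrix (Fin n) (Fin p) ℝ} (hpn : p < n)
    (hX : (gram X).rank = p) {x₀ : Fin p → ℝ} {S : Finset (Fin p)} (hω : omegaS X x₀ S ≠ 0)
    (y : Fin n → ℝ) : IsDistributionFunction fun r => confDist X x₀ S r y := by
  have hm : n - p ≠ 0 := by omega
  have hW := quadWide_pos hX hω
  have hΩ := quadOmega_pos hX hω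
  have hsq := sq_nonneg (kappaHat X x₀ S y)
  refine ⟨fun r r' h => ?_, fun r => ?_, ?_, ?_⟩
  · rcases lt_or_ge r (rrMin X x₀ S) with hr | hr
    · simp only [confDist_of_lt hr]
      exact confDist_nonneg _ _ _ _ _
    · simp only [confDist_of_le hr, confDist_of_le (hr.trans h)]
      refine sub_le_sub_left (antitone_cdf_noncentralF hm hsq ?_) _
      gcongr
  · rcases lt_or_ge r (rrMin X x₀ S) with hr | hr
    · refine ContinuousAt.continuousWithinAt
        (continuousAt_const.congr (f := fun _ => (0 : ℝ)) ?_)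
      filter_upwards [Iio_mem_nhds hr] with r' hr'
      exact (confDist_of_lt hr' y).symm
    -- To the right of such `r` only the upper formula is in force, so the jump at the minimum does
    -- not interfere.
    · refine ContinuousWithinAt.congr (Continuous.continuousWithinAt ?_)
        (fun r' hr' => confDist_of_le (hr.trans hr') y) (confDist_of_le hr y)
      exact continuous_const.sub ((continuous_cdf_noncentralF hm hsq).comp (by fun_prop))
  · refine tendsto_const_nhds.congr' ?_
    filter_upwards [eventually_lt_atBot (rrMin X x₀ S)] with r hr
    exact (confDist_of_lt hr y).symm
  · have h : Tendsto (fun r => (quadWide X x₀ * r - quadS X x₀ S) / quadOmega X x₀ S)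
        atTop atTop := by
      refine Tendsto.atTop_div_const hΩ ?_
      simp only [sub_eq_add_neg]
      exact tendsto_atTop_add_const_right _ _ (tendsto_id.const_mul_atTop hW)
    have h1 := ((tendsto_cdf_noncentralF hm hsq).comp h).const_sub 1
    rw [sub_zero] at h1
    refine h1.congr' ?_
    filter_upwards [eventually_ge_atTop (rrMin X x₀ S)] with r hr
    exact (confDist_of_le hr y).symm

theorem measurable_confDist {X : Matrix (Fin n) (Fin p) ℝ} (hn : n ≠ 0)
    (hX : (gram X).rank = p) (x₀ : Fin p → ℝ) (S : Finset (Fin p)) (r : ℝ) :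
    Measurable (confDist X x₀ S r) := by
  rcases lt_or_ge r (rrMin X x₀ S) with hr | hr
  · rw [show confDist X x₀ S r = fun _ => 0 from funext (confDist_of_lt hr)]
    exact measurable_const
  · rw [funext (confDist_of_le hr)]
    exact measurable_const.sub ((monotone_cdf _).measurable.comp
      ((measurable_kappaHat hn hX x₀ S).pow_const 2))

/-- At the true relative risk the noncentrality in C equals κ², the one in the law of κ̂². The lower
bound on the relative risk guarantees that the nonzero branch applies. -/
theorem model_real_confDist_rr_le {X : Matrix (Fin n) (Fin p) ℝ} (hpn : p < n)
    (hX : (gram X).rank = p) {x₀ : Fin p → ℝ} {S : Finset (Fin p)} (hω : omegaS X x₀ S ≠ 0)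
    (β : Fin p → ℝ) {σ : ℝ} (hσ : 0 < σ) {α : ℝ} (hα : α ∈ Set.Ioo (0 : ℝ) 1) :
    (model X β σ).real {y | confDist X x₀ S (rr X x₀ S β σ) y ≤ α} = α := by
  have hn : n ≠ 0 := by omega
  have := nullSingletonClass_noncentralF (m := n - p) (by omega) (kappa X x₀ S β σ ^ 2)
  simp_rw [confDist_of_le (rrMin_le_rr hn hX hω β hσ), noncentrality_rr hn hX hω β hσ]
  rw [(hasLaw_kappaHat_sq hpn hX hω β hσ).measureReal_eq
    (p := fun x => 1 - cdf (noncentralF 1 (n - p) (kappa X x₀ S β σ ^ 2)) x ≤ α)]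
  · exact measureReal_one_sub_cdf_le _ hα
  · exact measurableSet_le (measurable_const.sub (monotone_cdf _).measurable) measurable_const

theorem exists_measure_confDist {X : Matrix (Fin n) (Fin p) ℝ} (hpn : p < n)
    (hX : (gram X).rank = p) {x₀ : Fin p → ℝ} {S : Finset (Fin p)} (hω : omegaS X x₀ S ≠ 0)
    (y : Fin n → ℝ) :
    ∃ ν : Measure ℝ, IsProbabilityMeasure ν ∧
      (∀ r, ν.real (Set.Iic r) = confDist X x₀ S r y) ∧
      ν.real {rrMin X x₀ S} = 1 - cdf (centralF 1 (n - p)) (kappaHat X x₀ S y ^ 2) ∧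
      0 < ν.real {rrMin X x₀ S} := by
  have hD := isDistributionFunction_confDist hpn hX hω y
  let f : StieltjesFunction ℝ := ⟨fun r => confDist X x₀ S r y, hD.monotone, hD.right_continuous⟩
  have hpt : f.measure.real {rrMin X x₀ S} =
      1 - cdf (centralF 1 (n - p)) (kappaHat X x₀ S y ^ 2) := by
    -- C vanishes below the minimum, so the atom is the whole value of C there, where the
    -- noncentrality is zero.
    have hl : Function.leftLim f (rrMin X x₀ S) = 0 := by
      refine leftLim_eq_of_tendsto (tendsto_const_nhds.congr' ?_)
      filter_upwards [self_mem_nhdsWithin] with r hr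
      exact (confDist_of_lt hr y).symm
    rw [measureReal_def, StieltjesFunction.measure_singleton, hl, sub_zero]
    change (ENNReal.ofReal (confDist X x₀ S (rrMin X x₀ S) y)).toReal = _
    rw [ENNReal.toReal_ofReal (confDist_nonneg _ _ _ _ _), confDist_of_le le_rfl,
      noncentrality_rrMin hX hω, noncentralF_zero]
  refine ⟨f.measure, f.isProbabilityMeasure hD.tendsto_atBot hD.tendsto_atTop, fun r => ?_, hpt, ?_⟩
  · rw [measureReal_def, f.measure_Iic hD.tendsto_atBot, sub_zero]
    exact ENNReal.toReal_ofReal (confDist_nonneg _ _ _ _ _)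
  · rw [hpt, ← noncentralF_zero, sub_pos]
    exact cdf_noncentralF_lt_one (by omega) _ (sq_nonneg _)

/-- By the orthogonal decomposition of the wide quadratic form, r = 1 corresponds to noncentrality
exactly one. -/
theorem confDist_one {X : Matrix (Fin n) (Fin p) ℝ}
    (hX : (gram X).rank = p) {x₀ : Fin p → ℝ} {S : Finset (Fin p)} (hω : omegaS X x₀ S ≠ 0)
    (y : Fin n → ℝ) :
    confDist X x₀ S 1 y = 1 - cdf (noncentralF 1 (n - p) 1) (kappaHat X x₀ S y ^ 2) := by
  rw [confDist_of_le (rrMin_le_one hX hω), mul_one, quadWide_eq_add hX x₀ S, add_sub_cancel_left,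
    div_self (quadOmega_pos hX hω).ne']

end FRIC

theorem mainTheorem2 {n p : ℕ} (hpn : p < n) (X : Matrix (Fin n) (Fin p) ℝ)
    (hX : (FRIC.gram X).rank = p) (x₀ : Fin p → ℝ) (S : Finset (Fin p))
    (hω : FRIC.omegaS X x₀ S ≠ 0) :
    -- exact distributions of the statistic and of its square, and the range of the relative risk
    (∀ (β : Fin p → ℝ) (σ : ℝ), 0 < σ →
      HasLaw (FRIC.kappaHat X x₀ S) (noncentralT (n - p) (FRIC.kappa X x₀ S β σ))
        (FRIC.model X β σ) ∧
      HasLaw (fun y => FRIC.kappaHat X x₀ S y ^ 2)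
        (noncentralF 1 (n - p) (FRIC.kappa X x₀ S β σ ^ 2)) (FRIC.model X β σ) ∧
      FRIC.rrMin X x₀ S ≤ FRIC.rr X x₀ S β σ) ∧
    -- exact confidence distribution for the relative risk
    IsExactConfidenceDistribution
      (fun θ : (Fin p → ℝ) × Set.Ioi (0 : ℝ) => FRIC.model X θ.1 θ.2)
      (fun θ => FRIC.rr X x₀ S θ.1 θ.2) (FRIC.confDist X x₀ S) ∧
    -- point mass at the minimum, and the value at one
    (∀ y : Fin n → ℝ,
      (∃ ν : Measure ℝ, IsProbabilityMeasure ν ∧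
        (∀ r, ν.real (Set.Iic r) = FRIC.confDist X x₀ S r y) ∧
        ν.real {FRIC.rrMin X x₀ S} =
          1 - cdf (centralF 1 (n - p)) (FRIC.kappaHat X x₀ S y ^ 2) ∧
        0 < ν.real {FRIC.rrMin X x₀ S}) ∧
      FRIC.confDist X x₀ S 1 y =
        1 - cdf (noncentralF 1 (n - p) 1) (FRIC.kappaHat X x₀ S y ^ 2)) := by
  have hn : n ≠ 0 := by omega
  refine ⟨fun β σ hσ => ⟨FRIC.hasLaw_kappaHat hpn hX hω β hσ, FRIC.hasLaw_kappaHat_sq hpn hX hω β hσ,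
      FRIC.rrMin_le_rr hn hX hω β hσ⟩,
    ⟨FRIC.isDistributionFunction_confDist hpn hX hω, FRIC.measurable_confDist hn hX x₀ S,
      fun θ α hα => FRIC.model_real_confDist_rr_le hpn hX hω θ.1 θ.2.2 hα⟩,
    fun y => ⟨FRIC.exists_measure_confDist hpn hX hω y, FRIC.confDist_one hX hω y⟩⟩
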